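/- Let $v=[2,1,2,0,0,1,0,0]$ be the $8$-periodic sequence with values in $\mathbb Z/4\mathbb Z$ with $v(0)=2,\ v(1)=1,\dots,v(7)=0$. For a sequence $f:\mathbb N\to\mathbb Z/4\mathbb Z$ let $\Sigma f$ be the sequence with $\Sigma f(0)=0$ and $\Sigma f(n+1)=f(n)+\Sigma f(n)$. Write $v^s=\Sigma^s v$, and let $Z(s)$ be the number of indices $0\le n<\tau$ with $v^s(n)=0$, where $\tau$ is the least positive period of $v^s$. For $k\ge 5$ put \begin{align*} (c_1,c_2,c_3,c_4)&=2^{k-5}(48,32,40,44),\\ (c'_1,c'_2,c'_3,c'_4)&=2^{k-5}(48,40,44,48),\\ (c''_1,c''_2,c''_3,c''_4)&=2^{k-5}(32,32,48,64). \end{align*} For $2^k\le s<2^k+2^{k-1}$ with binary digits $b_j$ (so $b_k=1$, $b_{k-1}=0$), let $E_s$ be the set of all $n=\sum_{j=0}^{k+1}a_j2^j$, $a_j\in\{0,1\}$, such that $a_k=1$, $a_{k-1}=1$, $a_{k-2}<b_{k-2}$ and $a_j\ge b_j$ for $0\le j\le k-3$. For $2^k+2^{k-2}\le s\le 2^k+2^{k-1}-5$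 let $$\mathfrak d_k(s)=|E_{s+1}\,\triangle\,E_{s+3}|,$$ that is, the number of entries equal to $2$ among the entries with index $0\le n<2^{k+2}$ of the sequence $2(\chi_{E_{s+1}}+\chi_{E_{s+3}})$ in $\mathbb Z/4\mathbb Z$. Then \begin{align*} \big(Z(s)\big)_{32\le s<64}=(&88,64,80,88,92,64,80,88,104,92,104,108,94,78,88,96,\\ &108,96,104,108,110,102,108,112,118,114,118,120,64,64,96,128), \end{align*} and for all $k\ge 6$ and $2^k\le s<2^{k+1}$ \[Z(s)=\begin{cases} 2Z(s-2^{k-1})&\text{if }2^k\le s\le 2^k+2^{k-2}-5,\\ Z(s-2^{k-1}-2^{k-3})+c_i&\text{if }s=2^k+2^{k-2}-5+i,\ i=1,2,3,4,\\ 2Z(s-2^{k-1})-\mathfrak d_k(s)&\text{if }2^k+2^{k-2}\le s\le 2^k+2^{k-1}-5,\\ Z(s-2^{k-1}-2^{k-2})+c'_i&\text{if }s=2^k+2^{k-1}-5+i,\ i=1,2,3,4,\\ Z(s-2^k)+2^{k+1}&\text{if }2^k+2^{k-1}\le s\le 2^{k+1}-5,\\ Z(s-2^k)+c''_i&\text{if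 }s=2^{k+1}-5+i,\ i=1,2,3,4. \end{cases}\] -/

import Mathlib

namespace Vieru

/-- The shift operator `θ` on sequences with values in `ℤ/m`. -/
def shift {m : ℕ} (f : ℕ → ZMod m) : ℕ → ZMod m := fun n => f (n + 1)

/-- The sum operator `Σ = Σ₀`: `Σ f (0) = 0` and `Σ f (n + 1) = f n + Σ f n`. -/
def sigma {m : ℕ} (f : ℕ → ZMod m) : ℕ → ZMod m
  | 0 => 0
  | n + 1 => f n + sigma f n

/-- The period `τ(f)`: the least positive `j` with `θ^j f = f`
(and `0` if the sequence is not periodic). -/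
noncomputable def period {m : ℕ} (f : ℕ → ZMod m) : ℕ :=
  Function.minimalPeriod shift f

/-- The number of zeros of `f` in one period. -/
noncomputable def zeros {m : ℕ} (f : ℕ → ZMod m) : ℕ :=
  ((Finset.range (period f)).filter fun x => f x = 0).card

/-- The 8-periodic sequence `v = [2, 1, 2, 0, 0, 1, 0, 0]` in `ℤ/4`. -/
def v (n : ℕ) : ZMod 4 :=
  (![2, 1, 2, 0, 0, 1, 0, 0] : Fin 8 → ZMod 4) ⟨n % 8, Nat.mod_lt n (by norm_num)⟩

/-- `Z(s)`: the number of zeros in one period of the primitive `Σ^s v`. -/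
noncomputable def Z (s : ℕ) : ℕ := zeros (sigma^[s] v)

/-- The set `E_s` for `s = ⌊1 0 b_{k-2} … b_0⌋₂` (base `p = 2`, exponent `ℓ = 2`): those
`n = ⌊a_{k+1} … a_0⌋₂ < 2^(k+2)` with `a_k = 1`, `a_{k-1} ≠ 0`, `a_{k-2} < b_{k-2}` and
`a_j ≥ b_j` for `0 ≤ j ≤ k - 3`. The digit `a_{k+1}` is free. -/
def E (k s : ℕ) : Finset ℕ :=
  (Finset.range (2 ^ (k + 2))).filter fun n =>
    n.testBit k = true ∧ n.testBit (k - 1) = true ∧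
    (n.testBit (k - 2) = false ∧ s.testBit (k - 2) = true) ∧
    ∀ j < k - 2, s.testBit j = true → n.testBit j = true

/-- The sequence `χ_{E_s} = [e_0, …, e_{2^(k+2) - 1}]` in `ℤ/4`, the indicator of `E_s` repeated
with step `2^(k+2)`. -/
def chi (k s : ℕ) (n : ℕ) : ZMod 4 := if n % 2 ^ (k + 2) ∈ E k s then 1 else 0

/-- `𝔡_k(s)`: the number of entries of 2-adic valuation `1` (that is, equal to `2` in `ℤ/4`) of
`2 (χ_{E_{s+1}} + χ_{E_{s+3}})` in the block `0 ≤ n < 2^(k+2)`; equivalently the number of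
elements of the symmetric difference of `E_{s+1}` and `E_{s+3}`. -/
def d (k s : ℕ) : ℕ :=
  ((Finset.range (2 ^ (k + 2))).filter fun n =>
    2 * (chi k (s + 1) n + chi k (s + 3) n) = 2).card

/-- `(c_1, c_2, c_3, c_4) = 2^(k-5) (48, 32, 40, 44)`; the entry `c_i` has index `i - 1`. -/
def c (k : ℕ) (i : Fin 4) : ℕ := 2 ^ (k - 5) * ![48, 32, 40, 44] i

/-- `(c'_1, c'_2, c'_3, c'_4) = 2^(k-5) (48, 40, 44, 48)`; the entry `c'_i` has index `i - 1`. -/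
def c' (k : ℕ) (i : Fin 4) : ℕ := 2 ^ (k - 5) * ![48, 40, 44, 48] i

/-- `(c''_1, c''_2, c''_3, c''_4) = 2^(k-5) (32, 32, 48, 64)`; the entry `c''_i` has index
`i - 1`. -/
def c'' (k : ℕ) (i : Fin 4) : ℕ := 2 ^ (k - 5) * ![32, 32, 48, 64] i

/-- The initial block `𝒵_5 = (Z(32), …, Z(63))`. -/
def Z5 : Fin 32 → ℕ :=
  ![88, 64, 80, 88, 92, 64, 80, 88, 104, 92, 104, 108, 94, 78, 88, 96,
    108, 96, 104, 108, 110, 102, 108, 112, 118, 114, 118, 120, 64, 64, 96, 128]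

end Vieru

namespace Vieru

/-! Up to sign, Σ^s v is column s + 4, from row 2 on, of the triangle of coefficients of (1 + x)^n
(2 + x + 2x²) over ℤ/4 (`iterate_sigma_v`). For 2^k < s + 4 ≤ 2^(k+1) this column has period
2^(k+2), so Z(s) counts zeros in 2^(k+2) rows of one column.

For M a power of two, (1 + x)^(2M) = (1 + x^M)² in ℤ/4[x]. Hence the entry in row m + 2Me and column
TM + r combines the entries of row m in columns r, M + r, 2M + r, with coefficients C(2e, T), C(2e,
T - 1), C(2e, T - 2) (`a_block`). With M = 2^(k-2), level k has 8 values of e and level k - 1 has 4,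
so comparing the two levels amounts to finitely many identities in ℤ/4, provided the parity
relations between the three entries are known.

Those relations hold for r ≥ 4 and give cases A, C, E. In C the identity fails by 2 at each odd
entry in the first M rows, and Lucas' theorem identifies this defect with `d` (`d_eq`). The columns
r = 0, 1, 2, 3 have explicit zero counts, linear in M (`zeroCount_five`, `zeroCount_six`,
`zeroCount_eight`); subtracting consecutive levels gives B, D, F. -/

/-! ### The coefficient triangle over ℤ/4 -/

/-- The coefficient of `x ^ t` in `(1 + x) ^ n * (2 + x + 2 * x ^ 2)` over `ℤ/4`. -/
def a : ℕ → ℤ → ZMod 4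
  | 0, t => if t = 0 ∨ t = 2 then 2 else if t = 1 then 1 else 0
  | n + 1, t => a n t + a n (t - 1)

theorem a_zero (t : ℤ) : a 0 t = if t = 0 ∨ t = 2 then 2 else if t = 1 then 1 else 0 := rfl

theorem a_succ (n : ℕ) (t : ℤ) : a (n + 1) t = a n t + a n (t - 1) := rfl

theorem a_of_neg (n : ℕ) {t : ℤ} (ht : t < 0) : a n t = 0 := by
  induction n generalizing t with
  | zero => rw [a_zero, if_neg (by omega), if_neg (by omega)]
  | succ n ih => rw [a_succ, ih ht, ih (by omega), add_zero]

theorem a_of_lt (n : ℕ) {t : ℤ} (ht : n + 2 < t) : a n t = 0 := by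
  induction n generalizing t with
  | zero => rw [a_zero, if_neg (by omega), if_neg (by omega)]
  | succ n ih => push_cast at ht; rw [a_succ, ih (by omega), ih (by omega), add_zero]

theorem four_eq_zero : (4 : ZMod 4) = 0 := rfl

/-- With y = x^(2^j), squaring 1 + 2y + y² gives 1 + 4y + 6y² + 4y³ + y⁴ = 1 + 2y² + y⁴ modulo 4, so
the shape survives each doubling. -/
theorem a_add_two_pow (j n : ℕ) (t : ℤ) :
    a (n + 2 ^ (j + 1)) t = a n t + 2 * a n (t - 2 ^ j) + a n (t - 2 ^ (j + 1)) := by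
  induction j generalizing n t with
  | zero =>
    show a (n + 1 + 1) t = _
    simp only [a_succ]
    rw [show t - 1 - 1 = t - 2 ^ (0 + 1) by ring, pow_zero]
    ring
  | succ j ih =>
    have h4 := four_eq_zero
    rw [show n + 2 ^ (j + 1 + 1) = n + 2 ^ (j + 1) + 2 ^ (j + 1) by ring, ih, ih, ih, ih]
    have e1 : t - 2 ^ (j + 1) = t - 2 ^ j - 2 ^ j := by ring
    have e2 : t - 2 ^ j - 2 ^ (j + 1) = t - 2 ^ (j + 1) - 2 ^ j := by ring
    have e3 : t - 2 ^ (j + 1) - 2 ^ (j + 1) = t - 2 ^ (j + 1 + 1) := by ring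
    rw [e2, e3, ← e1]
    linear_combination (a n (t - 2 ^ j) + a n (t - 2 ^ (j + 1)) + a n (t - 2 ^ (j + 1) - 2 ^ j)) * h4

/-- Step of length `2 * M`, for `M` a power of two. -/
theorem a_add {M : ℕ} (hM : ∃ j, M = 2 ^ j) (n : ℕ) (t : ℤ) :
    a (n + 2 * M) t = a n t + 2 * a n (t - M) + a n (t - 2 * M) := by
  obtain ⟨j, rfl⟩ := hM
  have := a_add_two_pow j n t
  rw [show n + 2 * 2 ^ j = n + 2 ^ (j + 1) by ring, this]
  push_cast
  rw [show (2 : ℤ) * 2 ^ j = 2 ^ (j + 1) by ring]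

theorem a_col_zero (n : ℕ) : a n 0 = 2 := by
  induction n with
  | zero => rfl
  | succ n ih => rw [a_succ, ih, a_of_neg n (by norm_num), add_zero]

theorem a_last (n : ℕ) : a n (n + 2) = 2 := by
  induction n with
  | zero => rfl
  | succ n ih =>
    rw [a_succ, a_of_lt n (by push_cast; omega)]
    rw [show ((n + 1 : ℕ) : ℤ) + 2 - 1 = n + 2 by push_cast; ring, ih, zero_add]

theorem a_last_but_one (n : ℕ) : a n (n + 1) = 1 + 2 * n := by
  induction n with
  | zero => rfl
  | succ n ih =>
    rw [a_succ, show ((n + 1 : ℕ) : ℤ) + 1 = n + 2 by push_cast; ring, a_last,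
      show (n : ℤ) + 2 - 1 = n + 1 by ring, ih]
    push_cast
    ring

/-! ### The primitives of `v` -/

theorem a_add_eight {t : ℤ} (ht : t ≤ 4) (n : ℕ) : a (n + 8) t = a n t := by
  rw [show n + 8 = n + 2 * 4 by ring, a_add ⟨2, by norm_num⟩,
    a_of_neg n (show t - 2 * ((4 : ℕ) : ℤ) < 0 by push_cast; omega)]
  rcases eq_or_lt_of_le ht with rfl | h
  · norm_num [a_col_zero]; decide
  · rw [a_of_neg n (show t - ((4 : ℕ) : ℤ) < 0 by push_cast; omega)]; ring

theorem a_mod_eight {t : ℤ} (ht : t ≤ 4) (n : ℕ) : a n t = a (n % 8) t := by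
  conv_lhs => rw [← Nat.mod_add_div n 8]
  induction n / 8 with
  | zero => rfl
  | succ q ih => rw [show n % 8 + 8 * (q + 1) = n % 8 + 8 * q + 8 by ring, a_add_eight ht, ih]

theorem v_eq (n : ℕ) : v n = -a (n + 2) 4 := by
  have h : ∀ i : Fin 8, (![2, 1, 2, 0, 0, 1, 0, 0] : Fin 8 → ZMod 4) i = -a (i + 2) 4 := by
    decide +kernel
  rw [v, h, a_mod_eight le_rfl, a_mod_eight le_rfl (n + 2)]
  simp

/-- Row 2 has degree 4, so every later column vanishes there; this is the initial value 0 of Σ, and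
the triangle recursion is the recursion of Σ. -/
theorem iterate_sigma_v (s n : ℕ) : sigma^[s] v n = -a (n + 2) (s + 4) := by
  induction s generalizing n with
  | zero => simp [v_eq]
  | succ s ih =>
    rw [Function.iterate_succ_apply']
    induction n with
    | zero => rw [a_of_lt _ (by push_cast; omega)]; simp [sigma]
    | succ n ihn =>
      rw [sigma, ihn, ih, show n + 1 + 2 = n + 2 + 1 by ring, a_succ (n + 2),
        show ((s + 1 : ℕ) : ℤ) + 4 - 1 = s + 4 by push_cast; ring]
      ring

theorem shift_iterate {m : ℕ} (p : ℕ) (f : ℕ → ZMod m) (n : ℕ) : shift^[p] f n = f (n + p) := by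
  induction p generalizing n with
  | zero => rfl
  | succ p ih => rw [Function.iterate_succ_apply', shift, ih]; congr 1; ring

theorem a_periodic {k : ℕ} {t : ℤ} (ht : t ≤ 2 ^ (k + 1)) (n : ℕ) :
    a (n + 2 ^ (k + 2)) t = a n t := by
  have h2 : (0 : ℤ) < 2 ^ (k + 1) := by positivity
  rw [a_add_two_pow (k + 1), a_of_neg n (show t - 2 ^ (k + 1 + 1) < 0 by rw [pow_succ]; omega)]
  rcases eq_or_lt_of_le ht with rfl | h
  · rw [sub_self, a_col_zero]; linear_combination four_eq_zero
  · rw [a_of_neg n (show t - 2 ^ (k + 1) < 0 by omega)]; ring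

theorem period_iterate_sigma_v {k s : ℕ} (h1 : 2 ^ k ≤ s + 3) (h2 : s + 3 < 2 ^ (k + 1)) :
    period (sigma^[s] v) = 2 ^ (k + 2) := by
  have ht : (s + 4 : ℤ) ≤ 2 ^ (k + 1) := by exact_mod_cast h2
  have hp : (2 : ℤ) ^ (k + 1) = 2 * 2 ^ k := by ring
  have h1' : (2 : ℤ) ^ k ≤ s + 3 := by exact_mod_cast h1
  have : Fact (Nat.Prime 2) := ⟨Nat.prime_two⟩
  apply Function.minimalPeriod_eq_prime_pow
  · intro h
    have key (n : ℕ) : a (n + 2 ^ (k + 1)) (s + 4) = a n (s + 4) := by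
      -- The sequences start at row 2; adding the period 2^(k+2) makes rows 0 and 1 accessible too.
      have := congrFun h (n + (2 ^ (k + 2) - 2))
      rw [shift_iterate, iterate_sigma_v, iterate_sigma_v, neg_inj] at this
      have hk : 2 ≤ 2 ^ (k + 2) := by rw [pow_succ]; have := Nat.one_le_two_pow (n := k + 1); omega
      rw [show n + (2 ^ (k + 2) - 2) + 2 ^ (k + 1) + 2 = n + 2 ^ (k + 1) + 2 ^ (k + 2) by omega,
        show n + (2 ^ (k + 2) - 2) + 2 = n + 2 ^ (k + 2) by omega, a_periodic ht,
        a_periodic ht] at this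
      exact this
    rcases eq_or_lt_of_le ht with heq | hlt
    · have := key 0
      rw [a_add_two_pow, heq, sub_self, a_col_zero, hp] at this
      rw [show (2 : ℤ) * 2 ^ k - 2 ^ k = 2 ^ k by ring, add_assoc, add_eq_left] at this
      rw [a_zero] at this
      split_ifs at this <;> first | exact absurd this (by decide) | omega
    -- In this row, column t - 2^k holds the last but one coefficient, which is odd, so its double
    -- is nonzero.
    · have := key (s + 3 - 2 ^ k)
      rw [a_add_two_pow, a_of_neg _ (show (s + 4 : ℤ) - 2 ^ (k + 1) < 0 by omega), add_zero,
        add_eq_left, show (s + 4 : ℤ) - 2 ^ k = ((s + 3 - 2 ^ k : ℕ) : ℤ) + 1 by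
          push_cast [Nat.cast_sub h1]; ring, a_last_but_one] at this
      have h4 : (2 : ZMod 4) = 0 := by linear_combination this - ((s + 3 - 2 ^ k : ℕ) : ZMod 4) * four_eq_zero
      exact absurd h4 (by decide)
  · funext n
    rw [shift_iterate, iterate_sigma_v, iterate_sigma_v,
      show n + 2 ^ (k + 1 + 1) + 2 = n + 2 + 2 ^ (k + 2) by ring, a_periodic ht]

/-- The number of `n < L` with `a n t = 0`. -/
def zeroCount (L : ℕ) (t : ℤ) : ℕ := ∑ n ∈ Finset.range L, if a n t = 0 then 1 else 0

theorem sum_range_shift {f : ℕ → ℕ} {L : ℕ} (hf : ∀ n, f (n + L) = f n) (c : ℕ) :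
    ∑ n ∈ Finset.range L, f (n + c) = ∑ n ∈ Finset.range L, f n := by
  induction c with
  | zero => rfl
  | succ c ih =>
    have e1 := Finset.sum_range_succ (fun n => f (n + c)) L
    have e2 := Finset.sum_range_succ' (fun n => f (n + c)) L
    rw [add_comm L c, hf] at e1
    rw [e1, zero_add] at e2
    rw [← ih, Nat.add_right_cancel e2]
    exact Finset.sum_congr rfl fun n _ => by rw [add_right_comm, add_assoc]

theorem Z_eq_zeroCount {k s : ℕ} (h1 : 2 ^ k ≤ s + 3) (h2 : s + 3 < 2 ^ (k + 1)) :
    Z s = zeroCount (2 ^ (k + 2)) (s + 4) := by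
  have ht : (s + 4 : ℤ) ≤ 2 ^ (k + 1) := by exact_mod_cast h2
  rw [Z, zeros, period_iterate_sigma_v h1 h2, Finset.card_filter, zeroCount,
    ← sum_range_shift (f := fun n => if a n (s + 4) = 0 then 1 else 0)
      (fun n => by rw [a_periodic ht]) 2]
  simp only [iterate_sigma_v, neg_eq_zero]

/-! ### Splitting the row index into blocks -/

/-- The number of `e < E` at which the combination of `x` with the binomial coefficients
`C(2e, T), C(2e, T - 1), C(2e, T - 2)` vanishes. -/
def blockZeros (T E : ℕ) (x y z : ZMod 4) : ℕ :=
  ((List.range E).filter fun e =>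
    (((2 * e).descFactorial T / T.factorial : ℕ) : ZMod 4) * x +
    (((2 * e).descFactorial (T - 1) / (T - 1).factorial : ℕ) : ZMod 4) * y +
    (((2 * e).descFactorial (T - 2) / (T - 2).factorial : ℕ) : ZMod 4) * z = 0).length

theorem a_block {M : ℕ} (hM : ∃ j, M = 2 ^ j) (h2 : 2 ≤ M) {m : ℕ} (hm : m < 2 * M) {r : ℕ}
    (hr : r < M) (e T : ℕ) :
    a (m + 2 * M * e) (T * M + r) = (2 * e).choose T * a m r +
      (if 1 ≤ T then ((2 * e).choose (T - 1) : ZMod 4) else 0) * a m (M + r) +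
      (if 2 ≤ T then ((2 * e).choose (T - 2) : ZMod 4) else 0) * a m (2 * M + r) := by
  induction e generalizing T with
  | zero =>
    match T with
    | 0 => simp
    | 1 => simp
    | 2 => simp
    | T + 3 =>
      rw [a_of_lt _ (by push_cast; nlinarith)]
      simp
  | succ e ih =>
    rw [show m + 2 * M * (e + 1) = m + 2 * M * e + 2 * M by ring, a_add hM]
    match T with
    | 0 =>
      rw [ih, a_of_neg _ (show ((0 : ℕ) : ℤ) * M + r - M < 0 by push_cast; omega),
        a_of_neg _ (show ((0 : ℕ) : ℤ) * M + r - 2 * M < 0 by push_cast; omega)]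
      simp
    | 1 =>
      rw [ih, a_of_neg _ (show ((1 : ℕ) : ℤ) * M + r - 2 * M < 0 by push_cast; omega),
        show ((1 : ℕ) : ℤ) * M + r - M = ((0 : ℕ) : ℤ) * M + r by push_cast; ring, ih]
      simp
      ring
    | T + 2 =>
      rw [ih, show ((T + 2 : ℕ) : ℤ) * M + r - M = ((T + 1 : ℕ) : ℤ) * M + r by push_cast; ring,
        show ((T + 2 : ℕ) : ℤ) * M + r - 2 * M = (T : ℤ) * M + r by push_cast; ring, ih, ih]
      have e1 (U : ℕ) : (2 * (e + 1)).choose (U + 2) =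
          (2 * e).choose (U + 2) + 2 * (2 * e).choose (U + 1) + (2 * e).choose U := by
        rw [show 2 * (e + 1) = 2 * e + 1 + 1 by ring, Nat.choose_succ_succ, Nat.choose_succ_succ,
          Nat.choose_succ_succ (2 * e) U.succ]
        simp only [Nat.succ_eq_add_one]
        ring
      match T with
      | 0 =>
        rw [e1]; simp; ring
      | 1 =>
        rw [show 1 + 2 - 1 = 0 + 2 by rfl, e1, e1]; simp; ring
      | T + 2 =>
        rw [show T + 2 + 2 - 1 = T + 1 + 2 by rfl, show T + 2 + 2 - 2 = T + 2 by rfl, e1, e1, e1]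
        simp
        ring

theorem sum_range_mul_eq (f : ℕ → ℕ) (A E : ℕ) :
    ∑ n ∈ Finset.range (A * E), f n =
      ∑ m ∈ Finset.range A, ∑ e ∈ Finset.range E, f (m + A * e) := by
  induction E with
  | zero => simp
  | succ E ih =>
    simp only [Finset.sum_range_succ, Finset.sum_add_distrib, ← ih]
    rw [mul_add, mul_one, Finset.sum_range_add]
    simp only [add_comm]

theorem zeroCount_eq {M : ℕ} (hM : ∃ j, M = 2 ^ j) (h2 : 2 ≤ M) {r T : ℕ} (hr : r < M)
    (hT : 2 ≤ T) (E : ℕ) {L : ℕ} (hL : L = 2 * M * E) {t : ℤ} (ht : t = T * M + r) :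
    zeroCount L t = ∑ m ∈ Finset.range (2 * M),
      blockZeros T E (a m r) (a m (M + r)) (a m (2 * M + r)) := by
  subst hL ht
  rw [zeroCount, sum_range_mul_eq]
  refine Finset.sum_congr rfl fun m hm => ?_
  rw [blockZeros, ← List.toFinset_card_of_nodup (List.nodup_range.filter _), ← Finset.card_filter]
  congr 1
  ext e
  simp only [Finset.mem_filter, Finset.mem_range, List.mem_toFinset, List.mem_filter,
    List.mem_range, decide_eq_true_eq]
  -- `blockZeros` uses truncated subtraction in T - 1 and T - 2; for T ≥ 2 no truncation occurs.
  rw [a_block hM h2 (Finset.mem_range.1 hm) hr, if_pos (by omega), if_pos hT]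
  simp only [Nat.choose_eq_descFactorial_div_factorial]

/-! ### Columns r ≥ 4: comparison of consecutive levels -/

theorem blockZeros_four_eight : ∀ x y : ZMod 4, 2 * y = 0 ∨ 2 * y = 2 * x →
    blockZeros 4 8 x y 0 = 2 * blockZeros 2 4 x y 0 := by decide +kernel

theorem blockZeros_five_eight : ∀ x : ZMod 4,
    blockZeros 5 8 x 0 0 + 2 * (if 2 * x = 2 then 1 else 0) = 2 * blockZeros 3 4 x 0 0 := by
  decide +kernel

theorem blockZeros_five_eight' : ∀ x y : ZMod 4, 2 * y = 2 * x →
    blockZeros 5 8 x y 0 = 2 * blockZeros 3 4 x y 0 := by decide +kernel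

theorem blockZeros_six_eight : ∀ x y : ZMod 4,
    blockZeros 6 8 x y 0 = blockZeros 2 4 x y 0 + 4 := by decide +kernel

theorem blockZeros_seven_eight : ∀ x y z : ZMod 4,
    blockZeros 7 8 x y z = blockZeros 3 4 x y z + 4 := by decide +kernel

variable {M : ℕ}

theorem two_mul_a_add (hM : ∃ j, M = 2 ^ j) (n : ℕ) (t : ℤ) :
    2 * a (n + 2 * M) t = 2 * a n t + 2 * a n (t - 2 * M) := by
  rw [a_add hM]; linear_combination a n (t - M) * four_eq_zero

theorem sum_range_two_mul (f : ℕ → ℕ) (M : ℕ) :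
    ∑ m ∈ Finset.range (2 * M), f m = ∑ m ∈ Finset.range M, (f m + f (m + M)) := by
  rw [two_mul, Finset.sum_range_add, Finset.sum_add_distrib]
  simp only [add_comm]

/-- Here `2 * M` is the distance between the two columns. -/
theorem two_mul_a_column (hM : ∃ j, M = 2 ^ j) {m : ℕ} (hm : m < 2 * M) {r : ℕ} (hr : r < 2 * M)
    (hr' : 2 ≤ r) : 2 * a (m + 2 * M) ((2 * M : ℕ) + r) = 2 * a (m + 2 * M) r := by
  -- Modulo 2 the factor (1 + x)^(2M) is 1 + x^(2M); both columns reduce to column r of row m, whose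
  -- degree is below 2M + r.
  rw [two_mul_a_add hM, two_mul_a_add hM, a_of_lt m (show (m : ℤ) + 2 < (2 * M : ℕ) + r by omega),
    a_of_neg m (show (r : ℤ) - 2 * M < 0 by omega)]
  push_cast
  rw [add_sub_cancel_left]; ring

theorem zeroCount_first_quarter {j : ℕ} (hj : 1 ≤ j) {r : ℕ} (h4 : 4 ≤ r) (hr : r < 2 ^ j) :
    zeroCount (2 ^ (j + 4)) (4 * 2 ^ j + r) = 2 * zeroCount (2 ^ (j + 3)) (2 * 2 ^ j + r) := by
  obtain ⟨i, rfl⟩ := Nat.exists_eq_add_of_le' hj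
  have hN : 2 ^ (i + 1) = 2 * 2 ^ i := by ring
  have h1 := Nat.one_le_two_pow (n := i)
  rw [zeroCount_eq ⟨i + 1, rfl⟩ (by omega) hr (T := 4) (by norm_num) 8 (by ring) (by push_cast; ring),
    zeroCount_eq ⟨i + 1, rfl⟩ (by omega) hr (T := 2) (by norm_num) 4 (by ring) (by push_cast; ring),
    Finset.mul_sum]
  refine Finset.sum_congr rfl fun m hm => ?_
  have hm := Finset.mem_range.1 hm
  rw [a_of_lt m (show (m : ℤ) + 2 < 2 * (2 ^ (i + 1) : ℕ) + r by omega)]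
  apply blockZeros_four_eight
  rcases lt_or_ge m (2 ^ (i + 1)) with h | h
  -- For m < M column M + r lies beyond the degree of row m; for m ≥ M it agrees modulo 2 with
  -- column r.
  · left; rw [a_of_lt m (by omega), mul_zero]
  · right
    obtain ⟨m, rfl⟩ := Nat.exists_eq_add_of_le' h
    rw [hN]
    exact two_mul_a_column ⟨i, rfl⟩ (by omega) (by omega) (by omega)

theorem zeroCount_second_quarter {j : ℕ} (hj : 1 ≤ j) {r : ℕ} (h4 : 4 ≤ r) (hr : r < 2 ^ j) :
    zeroCount (2 ^ (j + 4)) (5 * 2 ^ j + r) +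
      2 * (∑ m ∈ Finset.range (2 ^ j), if 2 * a m r = 2 then 1 else 0) =
    2 * zeroCount (2 ^ (j + 3)) (3 * 2 ^ j + r) := by
  obtain ⟨i, rfl⟩ := Nat.exists_eq_add_of_le' hj
  have hN : 2 ^ (i + 1) = 2 * 2 ^ i := by ring
  have h1 := Nat.one_le_two_pow (n := i)
  rw [zeroCount_eq ⟨i + 1, rfl⟩ (by omega) hr (T := 5) (by norm_num) 8 (by ring) (by push_cast; ring),
    zeroCount_eq ⟨i + 1, rfl⟩ (by omega) hr (T := 3) (by norm_num) 4 (by ring) (by push_cast; ring),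
    Finset.mul_sum, Finset.mul_sum, sum_range_two_mul, sum_range_two_mul, ← Finset.sum_add_distrib]
  refine Finset.sum_congr rfl fun m hm => ?_
  have hm := Finset.mem_range.1 hm
  rw [a_of_lt m (show (m : ℤ) + 2 < 2 * (2 ^ (i + 1) : ℕ) + r by omega),
    a_of_lt m (show (m : ℤ) + 2 < (2 ^ (i + 1) : ℕ) + r by omega),
    a_of_lt _ (show ((m + 2 ^ (i + 1) : ℕ) : ℤ) + 2 < 2 * (2 ^ (i + 1) : ℕ) + r by
      exact_mod_cast (show m + 2 ^ (i + 1) + 2 < 2 * 2 ^ (i + 1) + r by omega)),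
    -- Only the rows m < M contribute the correction; in the rows m + M the columns r and M + r have
    -- equal parity.
    ← blockZeros_five_eight, blockZeros_five_eight' (a (m + 2 ^ (i + 1)) r)]
  · ring
  · rw [hN]
    exact two_mul_a_column ⟨i, rfl⟩ (by omega) (by omega) (by omega)

theorem zeroCount_second_half {j : ℕ} (hj : 1 ≤ j) {r : ℕ} (h4 : 4 ≤ r) (hr : r < 2 * 2 ^ j) :
    zeroCount (2 ^ (j + 4)) (6 * 2 ^ j + r) =
      zeroCount (2 ^ (j + 3)) (2 * 2 ^ j + r) + 2 ^ (j + 3) := by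
  have h2 : 2 ≤ 2 ^ j := Nat.le_self_pow (by omega) 2
  have hc : 2 ^ (j + 3) = ∑ m ∈ Finset.range (2 * 2 ^ j), 4 := by
    rw [Finset.sum_const, Finset.card_range, smul_eq_mul]; ring
  rcases lt_or_ge r (2 ^ j) with h | h
  · rw [zeroCount_eq ⟨j, rfl⟩ h2 h (T := 6) (by norm_num) 8 (by ring) (by push_cast; ring),
      zeroCount_eq ⟨j, rfl⟩ h2 h (T := 2) (by norm_num) 4 (by ring) (by push_cast; ring),
      hc, ← Finset.sum_add_distrib]
    refine Finset.sum_congr rfl fun m hm => ?_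
    have hm := Finset.mem_range.1 hm
    rw [a_of_lt m (show (m : ℤ) + 2 < 2 * (2 ^ j : ℕ) + r by omega), blockZeros_six_eight]
  · obtain ⟨r, rfl⟩ := Nat.exists_eq_add_of_le' h
    rw [zeroCount_eq ⟨j, rfl⟩ h2 (r := r) (by omega) (T := 7) (by norm_num) 8 (by ring)
        (by push_cast; ring),
      zeroCount_eq ⟨j, rfl⟩ h2 (r := r) (by omega) (T := 3) (by norm_num) 4 (by ring)
        (by push_cast; ring),
      hc, ← Finset.sum_add_distrib]
    exact Finset.sum_congr rfl fun m hm => blockZeros_seven_eight _ _ _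

/-! ### The four columns after a multiple of `M` -/

/-- Rows m, m + N, m + 2N, m + 3N with m < N depend only on z = a m N. By degree z = 0 except in the
last two rows, where z = 2 (m = N - 2) and z = 2N - 1 = 3 (m = N - 1). -/
theorem sum_column_zero (w : ZMod 4 → ZMod 4 → ZMod 4 → ℕ) {N : ℕ} (hN : ∃ j, 1 ≤ j ∧ N = 2 ^ j)
    (h4 : 4 ≤ N) {Φ : ZMod 4 → ℕ}
    (hΦ : ∀ z, Φ z = w 2 0 0 + w 2 z 0 + w 2 (2 * z + 2) 0 + w 2 (3 * z + 2) z) :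
    ∑ m ∈ Finset.range (4 * N), w (a m (0 : ℕ)) (a m ((2 * N : ℕ) + (0 : ℕ)))
      (a m (2 * (2 * N : ℕ) + (0 : ℕ))) = (N - 2) * Φ 0 + Φ 2 + Φ 3 := by
  obtain ⟨_ | i, hi, rfl⟩ := hN
  · omega
  have e : 2 ^ (i + 1) = 2 * 2 ^ i := by ring
  have hstep : ∀ n t, a (n + 2 ^ (i + 1)) t = a n t + 2 * a n (t - (2 ^ i : ℕ)) +
    a n (t - (2 ^ (i + 1) : ℕ)) := by
      intro n t; rw [e, a_add ⟨i, rfl⟩]; push_cast; rfl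
  have hstep' : ∀ n t, a (n + 2 * 2 ^ (i + 1)) t = a n t + 2 * a n (t - (2 ^ (i + 1) : ℕ)) +
    a n (t - 2 * (2 ^ (i + 1) : ℕ)) := fun n t => a_add ⟨i + 1, rfl⟩ n t
  set N := 2 ^ (i + 1)
  set N' := 2 ^ i
  have hsum : ∀ f : ℕ → ℕ, ∑ m ∈ Finset.range (4 * N), f m = ∑ m ∈ Finset.range N,
      (f m + f (m + N) + f (m + 2 * N) + f (m + N + 2 * N)) := by
    intro f
    rw [show 4 * N = 2 * (2 * N) by ring, sum_range_two_mul, sum_range_two_mul]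
    exact Finset.sum_congr rfl fun m _ => by ring
  rw [hsum]
  trans ∑ m ∈ Finset.range N, Φ (a m N)
  · refine Finset.sum_congr rfl fun m hm => ?_
    have hm := Finset.mem_range.1 hm
    have z1 : ∀ t : ℤ, (m : ℤ) + 2 < t → a m t = 0 := fun t ht => a_of_lt m ht
    have b1 : a (m + N) (2 * N : ℕ) = a m N := by
      rw [hstep, z1 _ (by push_cast; omega), z1 _ (by push_cast; omega)]
      push_cast; ring_nf
    have b1' : a (m + N) N = 2 * a m N' + a m N + 2 := by
      rw [hstep, show (N : ℤ) - N' = N' by omega, sub_self, a_col_zero]; ring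
    have b2 : a (m + 2 * N) (2 * N : ℕ) = 2 * a m N + 2 := by
      rw [hstep', z1 _ (by push_cast; omega), show ((2 * N : ℕ) : ℤ) - N = N by omega,
        show ((2 * N : ℕ) : ℤ) - 2 * N = 0 by omega, a_col_zero]; ring
    have b3 : a (m + N + 2 * N) (2 * N : ℕ) = 3 * a m N + 2 := by
      rw [hstep', b1, show ((2 * N : ℕ) : ℤ) - N = N by omega,
        show ((2 * N : ℕ) : ℤ) - 2 * N = 0 by omega, a_col_zero, b1']
      linear_combination (a m N' + 1) * four_eq_zero
    have c1 : a (m + N) (2 * (2 * N : ℕ)) = 0 := a_of_lt _ (by push_cast; omega)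
    have c2 : a (m + 2 * N) (2 * (2 * N : ℕ)) = 0 := a_of_lt _ (by push_cast; omega)
    have c3 : a (m + N + 2 * N) (2 * (2 * N : ℕ)) = a m N := by
      rw [hstep', c1, a_of_lt (m + N) (show ((m + N : ℕ) : ℤ) + 2 < 2 * (2 * N : ℕ) - N by
        push_cast; omega), show (2 * (2 * N : ℕ) : ℤ) - 2 * N = (2 * N : ℕ) by push_cast; ring, b1]
      ring
    simp only [Nat.cast_zero, add_zero, a_col_zero]
    rw [hΦ, z1 (2 * N : ℕ) (by push_cast; omega), z1 (2 * (2 * N : ℕ)) (by push_cast; omega),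
      b1, b2, b3, c1, c2, c3]
  obtain ⟨K, hK⟩ : ∃ K, N = K + 2 := ⟨N - 2, by omega⟩
  rw [show Finset.range N = Finset.range (K + 1 + 1) by rw [hK], Finset.sum_range_succ,
    Finset.sum_range_succ, show (N : ℤ) = ((K : ℕ) : ℤ) + 2 by omega, a_last,
    show (K : ℤ) + 2 = ((K + 1 : ℕ) : ℤ) + 1 by push_cast; ring, a_last_but_one]
  have hodd : (1 + 2 * ((K + 1 : ℕ) : ZMod 4)) = 3 := by
    obtain ⟨q, hq⟩ : ∃ q, K = 2 * q := ⟨N' - 1, by omega⟩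
    rw [hq]; push_cast; linear_combination (q : ZMod 4) * four_eq_zero
  rw [hodd, hK, Nat.add_sub_cancel]
  congr 2
  rw [Finset.sum_congr rfl (g := fun _ => Φ 0)]
  · simp
  · intro m hm
    rw [a_of_lt m (by have := Finset.mem_range.1 hm; push_cast; omega)]

/-- For `m < M` the rows `m` and `m + M` are expressed through row `m`. -/
theorem sum_columns (w : ZMod 4 → ZMod 4 → ZMod 4 → ℕ) {N : ℕ} (hN : ∃ j, N = 2 ^ j) {r : ℕ}
    (hr : r < N) (h1 : 2 ≤ N + r) :
    ∑ m ∈ Finset.range (2 * (2 * N)), w (a m r) (a m ((2 * N : ℕ) + r)) (a m (2 * (2 * N : ℕ) + r)) =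
      ∑ m ∈ Finset.range (2 * N), (w (a m r) (a m ((2 * N : ℕ) + r)) 0 +
        w (a m r) (a m ((2 * N : ℕ) + r) + 2 * a m (N + r) + a m r) (a m ((2 * N : ℕ) + r))) := by
  rw [sum_range_two_mul]
  refine Finset.sum_congr rfl fun m hm => ?_
  have hm := Finset.mem_range.1 hm
  have z : ∀ t : ℤ, (m : ℤ) + 2 < t → a m t = 0 := fun t ht => a_of_lt m ht
  rw [z _ (show (m : ℤ) + 2 < 2 * (2 * N : ℕ) + r by push_cast; omega)]
  congr 2
  · rw [a_add hN, a_of_neg m (show (r : ℤ) - N < 0 by omega),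
      a_of_neg m (show (r : ℤ) - 2 * N < 0 by omega)]; ring
  · rw [a_add hN]; push_cast; ring_nf
  · rw [a_add hN, z _ (by push_cast; omega), z _ (by push_cast; omega)]; push_cast; ring_nf

theorem sum_range_mod_eight (G : ℕ → ℕ) (q : ℕ) :
    ∑ m ∈ Finset.range (8 * q), G (m % 8) = q * ∑ i ∈ Finset.range 8, G i := by
  rw [sum_range_mul_eq, Finset.mul_sum]
  refine Finset.sum_congr rfl fun i hi => ?_
  have := Finset.mem_range.1 hi
  simp [Nat.add_mul_mod_self_left, Nat.mod_eq_of_lt this]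

theorem two_mul_a_two (q n : ℕ) : 2 * a (2 * n) (2 * q) = 0 := by
  induction n generalizing q with
  | zero => rw [mul_zero, a_zero]; split_ifs <;> first | rfl | omega
  | succ n ih =>
    rw [show 2 * (n + 1) = 2 * n + 2 * 1 by ring, two_mul_a_add ⟨0, by norm_num⟩, ih]
    rcases q with _ | q
    · rw [a_of_neg _ (by norm_num), mul_zero, add_zero]
    · rw [show (2 * (q + 1 : ℕ) : ℤ) - 2 * (1 : ℕ) = 2 * (q : ℕ) by push_cast; ring, ih]; ring

theorem two_mul_a_three (q n i : ℕ) (hi : i < 2) : 2 * a (4 * n + i) (4 * q + 3) = 0 := by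
  induction n generalizing q with
  | zero =>
    rcases q with _ | q
    · interval_cases i <;> decide
    · rw [a_of_lt _ (by push_cast; omega)]; ring
  | succ n ih =>
    rw [show 4 * (n + 1) + i = 4 * n + i + 2 * 2 by ring, two_mul_a_add ⟨1, by norm_num⟩, ih]
    rcases q with _ | q
    · rw [a_of_neg _ (by norm_num), mul_zero, add_zero]
    · rw [show (4 * (q + 1 : ℕ) + 3 : ℤ) - 2 * (2 : ℕ) = 4 * (q : ℕ) + 3 by push_cast; ring, ih]
      ring

/-- The function Φ of `sum_column_zero`; its terms belong to the rows m, m + N, m + 2N, m + 3N. -/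
def columnZeros (T E : ℕ) (z : ZMod 4) : ℕ :=
  blockZeros T E 2 0 0 + blockZeros T E 2 z 0 + blockZeros T E 2 (2 * z + 2) 0 +
    blockZeros T E 2 (3 * z + 2) z

theorem zeroCount_column_zero {j : ℕ} (hj : 1 ≤ j) {T : ℕ} (hT : 2 ≤ T) (E : ℕ) :
    zeroCount (2 ^ (j + 3) * E) (T * 2 ^ (j + 2)) =
      (2 ^ (j + 1) - 2) * columnZeros T E 0 + columnZeros T E 2 + columnZeros T E 3 := by
  have h2 : 2 ≤ 2 ^ j := Nat.le_self_pow (by omega) 2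
  have e : 2 ^ (j + 1) = 2 * 2 ^ j := by ring
  rw [zeroCount_eq (M := 2 * 2 ^ (j + 1)) ⟨j + 2, by ring⟩ (by omega) (r := 0) (by omega) hT E
    (by ring) (by push_cast; ring), ← sum_column_zero (Φ := columnZeros T E) (blockZeros T E)
    ⟨j + 1, by omega, rfl⟩ (by omega) (fun _ => rfl), show 2 * (2 * 2 ^ (j + 1)) = 4 * 2 ^ (j + 1) by
      ring]

theorem two_mul_a_one (n : ℕ) : 2 * a n 1 = 2 := by
  induction n with
  | zero => rfl
  | succ n ih => rw [a_succ, sub_self, a_col_zero, mul_add, ih]; rfl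

theorem zeroCount_columns {j : ℕ} (hj : 1 ≤ j) {T : ℕ} (hT : 2 ≤ T) (E : ℕ) {r : ℕ} (hr : r ≤ 3) :
    zeroCount (2 ^ (j + 3) * E) (T * 2 ^ (j + 2) + r) =
      ∑ m ∈ Finset.range (2 ^ (j + 2)), (blockZeros T E (a m r) (a m ((2 ^ (j + 2) : ℕ) + r)) 0 +
        blockZeros T E (a m r) (a m ((2 ^ (j + 2) : ℕ) + r) + 2 * a m ((2 ^ (j + 1) : ℕ) + r) + a m r)
          (a m ((2 ^ (j + 2) : ℕ) + r))) := by
  have h2 : 2 ≤ 2 ^ j := Nat.le_self_pow (by omega) 2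
  have e : 2 ^ (j + 1) = 2 * 2 ^ j := by ring
  rw [zeroCount_eq (M := 2 * 2 ^ (j + 1)) ⟨j + 2, by ring⟩ (by omega) (r := r) (by omega) hT E
    (by ring) (by push_cast; ring), sum_columns (blockZeros T E) ⟨j + 1, rfl⟩ (by omega) (by omega),
    show 2 ^ (j + 2) = 2 * 2 ^ (j + 1) by ring]

/-- Column 1 is odd throughout. Column 2^(j+2) + 1 vanishes in rows m < 2^(j+2) except the last,
where it is 2; p counts an ordinary row and q the last one. -/
theorem zeroCount_column_one {j : ℕ} (hj : 1 ≤ j) {T : ℕ} (hT : 2 ≤ T) (E : ℕ) {p q : ℕ}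
    (hp : ∀ x y : ZMod 4, 2 * x = 2 →
      blockZeros T E x 0 0 + blockZeros T E x (0 + 2 * y + x) 0 = p)
    (hq : ∀ x y : ZMod 4, 2 * x = 2 →
      blockZeros T E x 2 0 + blockZeros T E x (2 + 2 * y + x) 2 = q) :
    zeroCount (2 ^ (j + 3) * E) (T * 2 ^ (j + 2) + 1) = (2 ^ (j + 2) - 1) * p + q := by
  have := zeroCount_columns hj hT E (r := 1) (by norm_num)
  rw [Nat.cast_one] at this
  rw [this]
  obtain ⟨K, hK⟩ : ∃ K, 2 ^ (j + 2) = K + 1 := ⟨_, (Nat.sub_add_cancel Nat.one_le_two_pow).symm⟩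
  rw [hK, Finset.sum_range_succ, show ((K + 1 : ℕ) : ℤ) + 1 = K + 2 by push_cast; ring, a_last,
    hq _ _ (two_mul_a_one K), Finset.sum_congr rfl (g := fun _ => p)]
  · simp
  · intro m hm
    have hm := Finset.mem_range.1 hm
    rw [a_of_lt m (show (m : ℤ) + 2 < K + 2 by omega), hp _ _ (two_mul_a_one m)]

/-- Column 2^(j+2) + r is now zero in all rows m < 2^(j+2), and column r has period 8 in m. The
remaining entry y enters as 2y, which vanishes for half of the residues of m (`two_mul_a_two`,
`two_mul_a_three`); `hw` says it does not affect the count elsewhere either. -/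
theorem zeroCount_column_of_two_le {j : ℕ} (hj : 1 ≤ j) {T : ℕ} (hT : 2 ≤ T) (E : ℕ) {r : ℕ}
    (h2 : 2 ≤ r) (h3 : r ≤ 3)
    (hw : ∀ i : Fin 8, ∀ y : ZMod 4, ((i : ℕ) % 2 ^ (r - 1) < 2 ^ (r - 2) → 2 * y = 0) →
      blockZeros T E (a i r) (2 * y + a i r) 0 = blockZeros T E (a i r) (a i r) 0) :
    zeroCount (2 ^ (j + 3) * E) (T * 2 ^ (j + 2) + r) = 2 ^ (j - 1) *
      ∑ i ∈ Finset.range 8, (blockZeros T E (a i r) 0 0 + blockZeros T E (a i r) (a i r) 0) := by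
  rw [zeroCount_columns hj hT E h3, ← sum_range_mod_eight]
  have e : 2 ^ (j + 2) = 8 * 2 ^ (j - 1) := by
    rw [show j + 2 = 3 + (j - 1) by omega, pow_add]; norm_num
  rw [← e]
  refine Finset.sum_congr rfl fun m hm => ?_
  have hm := Finset.mem_range.1 hm
  rw [a_of_lt m (show (m : ℤ) + 2 < (2 ^ (j + 2) : ℕ) + r by omega),
    a_mod_eight (show (r : ℤ) ≤ 4 by omega) m]
  have := hw ⟨m % 8, Nat.mod_lt _ (by norm_num)⟩ (a m ((2 ^ (j + 1) : ℕ) + r)) ?_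
  · simp only at this
    rw [zero_add, this]
  · obtain ⟨i, rfl⟩ := Nat.exists_eq_add_of_le' hj
    intro h
    have h2 : r = 2 ∨ r = 3 := by omega
    rcases h2 with rfl | rfl
    · have := two_mul_a_two (2 ^ (i + 1) + 1) (m / 2)
      rw [show 2 * (m / 2) = m by norm_num at h; omega] at this
      convert this using 3
      push_cast; ring
    · have := two_mul_a_three (2 ^ i) (m / 4) (m % 4) (by norm_num at h; omega)
      rw [Nat.div_add_mod] at this
      convert this using 3
      push_cast; ring

theorem zeroCount_five {j : ℕ} (hj : 1 ≤ j) :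
    zeroCount (2 ^ (j + 6)) (5 * 2 ^ (j + 2)) + 4 = 12 * 2 ^ (j + 2) ∧
    zeroCount (2 ^ (j + 6)) (5 * 2 ^ (j + 2) + 1) = 8 * 2 ^ (j + 2) ∧
    zeroCount (2 ^ (j + 6)) (5 * 2 ^ (j + 2) + 2) = 10 * 2 ^ (j + 2) ∧
    zeroCount (2 ^ (j + 6)) (5 * 2 ^ (j + 2) + 3) = 11 * 2 ^ (j + 2) := by
  have e0 := zeroCount_column_zero hj (T := 5) (by norm_num) 8
  have e1 := zeroCount_column_one hj (T := 5) (by norm_num) 8 (p := 8) (q := 8)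
    (by decide +kernel) (by decide +kernel)
  have e2 := zeroCount_column_of_two_le hj (T := 5) (by norm_num) 8 (r := 2) le_rfl (by norm_num)
    (by decide +kernel)
  have e3 := zeroCount_column_of_two_le hj (T := 5) (by norm_num) 8 (r := 3) (by norm_num) le_rfl
    (by decide +kernel)
  have c0 : columnZeros 5 8 0 = 24 := by decide +kernel
  have c2 : columnZeros 5 8 2 + columnZeros 5 8 3 = 44 := by decide +kernel
  rw [show (∑ i ∈ Finset.range 8, (blockZeros 5 8 (a i (2 : ℕ)) 0 0 +
    blockZeros 5 8 (a i (2 : ℕ)) (a i (2 : ℕ)) 0)) = 80 by decide +kernel] at e2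
  rw [show (∑ i ∈ Finset.range 8, (blockZeros 5 8 (a i (3 : ℕ)) 0 0 +
    blockZeros 5 8 (a i (3 : ℕ)) (a i (3 : ℕ)) 0)) = 88 by decide +kernel] at e3
  rw [show 2 ^ (j + 3) * 8 = 2 ^ (j + 6) by ring] at e0 e1 e2 e3
  have p1 := Nat.one_le_two_pow (n := j - 1)
  have p : 2 ^ (j + 1) = 4 * 2 ^ (j - 1) := by
    rw [show j + 1 = 2 + (j - 1) by omega, pow_add]; norm_num
  have p' : 2 ^ (j + 2) = 8 * 2 ^ (j - 1) := by rw [pow_succ, p]; ring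
  push_cast at e0 e1 e2 e3
  rw [e0, e1, e2, e3, p, p', c0]
  omega

theorem zeroCount_six {j : ℕ} (hj : 1 ≤ j) :
    zeroCount (2 ^ (j + 6)) (6 * 2 ^ (j + 2)) + 2 = 12 * 2 ^ (j + 2) ∧
    zeroCount (2 ^ (j + 6)) (6 * 2 ^ (j + 2) + 1) + 2 = 10 * 2 ^ (j + 2) ∧
    zeroCount (2 ^ (j + 6)) (6 * 2 ^ (j + 2) + 2) = 11 * 2 ^ (j + 2) ∧
    zeroCount (2 ^ (j + 6)) (6 * 2 ^ (j + 2) + 3) = 12 * 2 ^ (j + 2) := by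
  have e0 := zeroCount_column_zero hj (T := 6) (by norm_num) 8
  have e1 := zeroCount_column_one hj (T := 6) (by norm_num) 8 (p := 10) (q := 8)
    (by decide +kernel) (by decide +kernel)
  have e2 := zeroCount_column_of_two_le hj (T := 6) (by norm_num) 8 (r := 2) le_rfl (by norm_num)
    (by decide +kernel)
  have e3 := zeroCount_column_of_two_le hj (T := 6) (by norm_num) 8 (r := 3) (by norm_num) le_rfl
    (by decide +kernel)
  have c0 : columnZeros 6 8 0 = 24 := by decide +kernel
  have c2 : columnZeros 6 8 2 + columnZeros 6 8 3 = 46 := by decide +kernel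
  rw [show (∑ i ∈ Finset.range 8, (blockZeros 6 8 (a i (2 : ℕ)) 0 0 +
    blockZeros 6 8 (a i (2 : ℕ)) (a i (2 : ℕ)) 0)) = 88 by decide +kernel] at e2
  rw [show (∑ i ∈ Finset.range 8, (blockZeros 6 8 (a i (3 : ℕ)) 0 0 +
    blockZeros 6 8 (a i (3 : ℕ)) (a i (3 : ℕ)) 0)) = 96 by decide +kernel] at e3
  rw [show 2 ^ (j + 3) * 8 = 2 ^ (j + 6) by ring] at e0 e1 e2 e3
  have p1 := Nat.one_le_two_pow (n := j - 1)
  have p : 2 ^ (j + 1) = 4 * 2 ^ (j - 1) := by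
    rw [show j + 1 = 2 + (j - 1) by omega, pow_add]; norm_num
  have p' : 2 ^ (j + 2) = 8 * 2 ^ (j - 1) := by rw [pow_succ, p]; ring
  push_cast at e0 e1 e2 e3
  rw [e0, e1, e2, e3, p, p', c0]
  omega

/-- Column 8 · 2^(j+2) is a power of two and still has the period of the lower level; the next three
columns have twice that period. -/
theorem zeroCount_eight {j : ℕ} (hj : 1 ≤ j) :
    zeroCount (2 ^ (j + 6)) (8 * 2 ^ (j + 2)) = 8 * 2 ^ (j + 2) ∧
    zeroCount (2 ^ (j + 7)) (8 * 2 ^ (j + 2) + 1) = 8 * 2 ^ (j + 2) ∧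
    zeroCount (2 ^ (j + 7)) (8 * 2 ^ (j + 2) + 2) = 12 * 2 ^ (j + 2) ∧
    zeroCount (2 ^ (j + 7)) (8 * 2 ^ (j + 2) + 3) = 16 * 2 ^ (j + 2) := by
  have e0 := zeroCount_column_zero hj (T := 8) (by norm_num) 8
  have e1 := zeroCount_column_one hj (T := 8) (by norm_num) 16 (p := 8) (q := 8)
    (by decide +kernel) (by decide +kernel)
  have e2 := zeroCount_column_of_two_le hj (T := 8) (by norm_num) 16 (r := 2) le_rfl (by norm_num)
    (by decide +kernel)
  have e3 := zeroCount_column_of_two_le hj (T := 8) (by norm_num) 16 (r := 3) (by norm_num) le_rfl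
    (by decide +kernel)
  have c0 : columnZeros 8 8 0 = 16 := by decide +kernel
  have c2 : columnZeros 8 8 2 + columnZeros 8 8 3 = 32 := by decide +kernel
  rw [show (∑ i ∈ Finset.range 8, (blockZeros 8 16 (a i (2 : ℕ)) 0 0 +
    blockZeros 8 16 (a i (2 : ℕ)) (a i (2 : ℕ)) 0)) = 96 by decide +kernel] at e2
  rw [show (∑ i ∈ Finset.range 8, (blockZeros 8 16 (a i (3 : ℕ)) 0 0 +
    blockZeros 8 16 (a i (3 : ℕ)) (a i (3 : ℕ)) 0)) = 128 by decide +kernel] at e3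
  rw [show 2 ^ (j + 3) * 8 = 2 ^ (j + 6) by ring] at e0
  rw [show 2 ^ (j + 3) * 16 = 2 ^ (j + 7) by ring] at e1 e2 e3
  have p1 := Nat.one_le_two_pow (n := j - 1)
  have p : 2 ^ (j + 1) = 4 * 2 ^ (j - 1) := by
    rw [show j + 1 = 2 + (j - 1) by omega, pow_add]; norm_num
  have p' : 2 ^ (j + 2) = 8 * 2 ^ (j - 1) := by rw [pow_succ, p]; ring
  push_cast at e0 e1 e2 e3
  rw [e0, e1, e2, e3, p, p', c0]
  omega

/-! ### The correction term `d` -/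

/-- Lucas' theorem modulo 2, peeling off the lowest binary digit. -/
theorem odd_choose_iff (n w : ℕ) :
    Odd (n.choose w) ↔ ∀ i, w.testBit i = true → n.testBit i = true := by
  induction w using Nat.strong_induction_on generalizing n with
  | _ w ih =>
    rcases Nat.eq_zero_or_pos w with rfl | hw
    · simp
    have : Fact (Nat.Prime 2) := ⟨Nat.prime_two⟩
    have hL := Choose.choose_modEq_choose_mod_mul_choose_div_nat (n := n) (k := w) (p := 2)
    have h0 : Odd ((n % 2).choose (w % 2)) ↔ (w.testBit 0 = true → n.testBit 0 = true) := by
      rw [Nat.testBit_zero, Nat.testBit_zero]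
      rcases Nat.mod_two_eq_zero_or_one n with h | h <;>
        rcases Nat.mod_two_eq_zero_or_one w with h' | h' <;> rw [h, h'] <;> decide
    rw [Nat.odd_iff, hL, ← Nat.odd_iff, Nat.odd_mul, h0, ih (w / 2) (by omega)]
    constructor
    · rintro ⟨h1, h2⟩ (_ | i) hi
      · exact h1 hi
      · rw [Nat.testBit_succ] at hi ⊢; exact h2 i hi
    · exact fun h => ⟨h 0, fun i hi => by
        rw [← Nat.testBit_succ] at hi ⊢; exact h _ hi⟩

/-- Twice 2 + x + 2x² is 2x in ℤ/4[x], so parities in the triangle are those of Pascal's triangle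
shifted by one column. -/
theorem two_mul_a_succ (n t : ℕ) : 2 * a n (t + 1) = 2 * (n.choose t : ZMod 4) := by
  induction n generalizing t with
  | zero =>
    rcases t with _ | _ | t
    · decide
    · decide
    · rw [a_of_lt _ (by push_cast; omega)]; simp
  | succ n ih =>
    rw [a_succ, add_sub_cancel_right]
    rcases t with _ | t
    · have := ih 0
      simp only [Nat.cast_zero, a_col_zero, mul_add, Nat.choose_zero_right] at this ⊢
      rw [this]; decide
    · rw [mul_add, ih, Nat.cast_add_one, ih, Nat.choose_succ_succ]; push_cast; ring

theorem two_mul_natCast_eq_two (n : ℕ) : 2 * (n : ZMod 4) = 2 ↔ Odd n := by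
  rcases Nat.even_or_odd' n with ⟨c, rfl | rfl⟩
  · have : 2 * ((2 * c : ℕ) : ZMod 4) = 0 := by
      push_cast; linear_combination (c : ZMod 4) * four_eq_zero
    simp only [this, Nat.not_odd_iff_even.2 (even_two_mul c), iff_false]; decide
  · have : 2 * ((2 * c + 1 : ℕ) : ZMod 4) = 2 := by
      push_cast; linear_combination (c : ZMod 4) * four_eq_zero
    rw [this]; simp

/-- The leading digits of s are 101₂ = 5. The top four digits of n form e, required to be 110₂ with
a free digit in front: 6 or 14. Domination of the lower digits is oddness of C(x, w). -/
theorem mem_E_iff {j w x e : ℕ} (hw : w < 2 ^ j) (hx : x < 2 ^ j) (he : e < 16) :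
    x + 2 ^ j * e ∈ E (j + 2) (2 ^ j * 5 + w) ↔ (e = 6 ∨ e = 14) ∧ 2 * a x (w + 1) = 2 := by
  have hlt : x + 2 ^ j * e < 2 ^ (j + 2 + 2) := by
    rw [show 2 ^ (j + 2 + 2) = 2 ^ j * 16 by ring]; nlinarith
  rw [two_mul_a_succ, two_mul_natCast_eq_two, odd_choose_iff, E, Finset.mem_filter,
    Finset.mem_range, and_iff_right hlt, add_comm x]
  simp only [Nat.testBit_two_pow_mul_add _ hx, Nat.testBit_two_pow_mul_add _ hw,
    show j + 2 - 1 = j + 1 by omega, show j + 2 - 2 = j by omega, lt_irrefl, if_false,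
    show ¬ j + 2 < j by omega, show ¬ j + 1 < j by omega, Nat.sub_self, Nat.add_sub_cancel_left]
  have h1 : (∀ i < j, (if i < j then w.testBit i else Nat.testBit 5 (i - j)) = true →
      (if i < j then x.testBit i else e.testBit (i - j)) = true) ↔
      ∀ i, w.testBit i = true → x.testBit i = true := by
    constructor
    · intro h i hi
      have hij : i < j := by
        by_contra hc
        rw [Nat.testBit_lt_two_pow (hw.trans_le (Nat.pow_le_pow_right (by norm_num) (by omega)))]
          at hi
        exact absurd hi (by decide)
      have := h i hij
      rw [if_pos hij, if_pos hij] at this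
      exact this hi
    · intro h i hij
      rw [if_pos hij, if_pos hij]
      exact h i
  rw [h1, ← and_assoc, ← and_assoc]
  refine and_congr_left fun _ => ?_
  interval_cases e <;> decide

theorem d_eq {j r : ℕ} (h4 : 4 ≤ r) (hr : r < 2 ^ j) {s : ℕ} (hs : s + 4 = 5 * 2 ^ j + r) :
    d (j + 2) s = 2 * ∑ m ∈ Finset.range (2 ^ j), if 2 * a m r = 2 then 1 else 0 := by
  -- Column r < 2^j has period 2^j modulo 2, so rows may be shifted by 2. This matches C(x, w) +
  -- C(x, w + 2) ≡ C(x + 2, w + 2) modulo 2, where w = r - 3.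
  have h2 : ∑ m ∈ Finset.range (2 ^ j), (if 2 * a m r = 2 then 1 else 0) =
      ∑ m ∈ Finset.range (2 ^ j), if 2 * a (m + 2) r = 2 then 1 else 0 := by
    refine (sum_range_shift (f := fun m => if 2 * a m r = 2 then 1 else 0) (fun n => ?_) 2).symm
    obtain ⟨i, rfl⟩ : ∃ i, j = i + 1 := ⟨j - 1, by
      rcases j with _ | j
      · omega
      · rfl⟩
    rw [show n + 2 ^ (i + 1) = n + 2 * 2 ^ i by ring, two_mul_a_add ⟨i, rfl⟩,
      a_of_neg n (show (r : ℤ) - 2 * (2 ^ i : ℕ) < 0 by push_cast; rw [pow_succ] at hr; zify at hr; omega)]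
    simp
  rw [d, Finset.card_filter, show 2 ^ (j + 2 + 2) = 2 ^ j * 16 by ring, sum_range_mul_eq, h2,
    Finset.mul_sum]
  refine Finset.sum_congr rfl fun x hx => ?_
  have hx := Finset.mem_range.1 hx
  obtain ⟨w, rfl⟩ := Nat.exists_eq_add_of_le' (show 3 ≤ r by omega)
  have key : ∀ e ∈ Finset.range 16,
      (if 2 * (chi (j + 2) (s + 1) (x + 2 ^ j * e) + chi (j + 2) (s + 3) (x + 2 ^ j * e)) = 2
        then 1 else 0) =
      if (e = 6 ∨ e = 14) then (if 2 * a (x + 2) (w + 3 : ℕ) = 2 then 1 else 0) else 0 := by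
    intro e he
    have he := Finset.mem_range.1 he
    have hlt : x + 2 ^ j * e < 2 ^ (j + 2 + 2) := by
      rw [show 2 ^ (j + 2 + 2) = 2 ^ j * 16 by ring]; nlinarith
    have ha : 2 * a (x + 2) (w + 3 : ℕ) = 2 * a x (w + 1) + 2 * a x ((w + 2 : ℕ) + 1) := by
      rw [show x + 2 = x + 2 * 1 by rfl, two_mul_a_add ⟨0, by norm_num⟩, add_comm]
      congr 3
      push_cast; ring
    rw [chi, chi, Nat.mod_eq_of_lt hlt, show s + 1 = 2 ^ j * 5 + w by omega,
      show s + 3 = 2 ^ j * 5 + (w + 2) by omega]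
    simp only [mem_E_iff (show w < 2 ^ j by omega) hx he,
      mem_E_iff (show w + 2 < 2 ^ j by omega) hx he, ha]
    have : ∀ p q : ZMod 4, (2 * ((if 2 * p = 2 then 1 else 0) + (if 2 * q = 2 then 1 else 0)) =
      (2 : ZMod 4)) ↔ 2 * p + 2 * q = 2 := by decide
    by_cases h : e = 6 ∨ e = 14
    · simp only [h, true_and, if_true, this]
    · simp only [h, false_and, if_false]; decide
  rw [Finset.sum_congr rfl key]
  generalize (if 2 * a (x + 2) (w + 3 : ℕ) = 2 then 1 else 0) = y
  simp [Finset.sum_range_succ, two_mul]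

/-! ### The initial block and the values of Z at the exceptional indices -/

theorem initial_block_of_lt : ∀ i : Fin 32, (i : ℕ) < 29 → ∑ m ∈ Finset.range 8,
    blockZeros ((36 + i) / 4) 16 (a m ((36 + i) % 4 : ℕ)) (a m ((4 : ℕ) + ((36 + i) % 4 : ℕ)))
      (a m (2 * (4 : ℕ) + ((36 + i) % 4 : ℕ))) = Z5 i := by decide +kernel

theorem initial_block_of_le : ∀ i : Fin 32, 29 ≤ (i : ℕ) → ∑ m ∈ Finset.range 8,
    blockZeros ((36 + i) / 4) 32 (a m ((36 + i) % 4 : ℕ)) (a m ((4 : ℕ) + ((36 + i) % 4 : ℕ)))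
      (a m (2 * (4 : ℕ) + ((36 + i) % 4 : ℕ))) = Z5 i := by decide +kernel

theorem Z_initial_block (i : Fin 32) : Z (2 ^ 5 + (i : ℕ)) = Z5 i := by
  have hi := i.isLt
  have ht : ((2 ^ 5 + (i : ℕ) : ℕ) : ℤ) + 4 =
    ((36 + (i : ℕ)) / 4 : ℕ) * (4 : ℕ) + ((36 + (i : ℕ)) % 4 : ℕ) := by omega
  -- From s = 61 on, s + 4 exceeds 64 and the period doubles from 128 to 256.
  rcases lt_or_ge (i : ℕ) 29 with h | h
  · rw [Z_eq_zeroCount (k := 5) (by omega) (by omega), zeroCount_eq (M := 4) ⟨2, rfl⟩ (by norm_num)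
      (Nat.mod_lt _ (by norm_num)) (by omega) 16 (by norm_num) ht]
    exact initial_block_of_lt i h
  · rw [Z_eq_zeroCount (k := 6) (by omega) (by omega), zeroCount_eq (M := 4) ⟨2, rfl⟩ (by norm_num)
      (Nat.mod_lt _ (by norm_num)) (by omega) 32 (by norm_num) ht]
    exact initial_block_of_le i h

theorem Z_eq {k s T j r : ℕ} (h1 : 2 ^ k ≤ s + 3) (h2 : s + 3 < 2 ^ (k + 1))
    (hs : s + 4 = T * 2 ^ j + r) : Z s = zeroCount (2 ^ (k + 2)) (T * 2 ^ j + r) := by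
  rw [Z_eq_zeroCount h1 h2]
  congr 1
  exact_mod_cast hs

/-- The added constants do not depend on j, so they cancel between consecutive levels and leave
exactly the c_i. -/
theorem Z_five {j : ℕ} (hj : 1 ≤ j) {s : ℕ} (i : Fin 4) (hs : s + 4 = 5 * 2 ^ (j + 2) + i) :
    Z s + ![4, 0, 0, 0] i = 2 ^ (j + 2) * ![12, 8, 10, 11] i := by
  have h2 : 2 ≤ 2 ^ j := Nat.le_self_pow (by omega) 2
  have e2 : 2 ^ (j + 2) = 4 * 2 ^ j := by ring
  have e4 : 2 ^ (j + 4) = 16 * 2 ^ j := by ring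
  have e5 : 2 ^ (j + 4 + 1) = 32 * 2 ^ j := by ring
  have hi := i.isLt
  rw [Z_eq (k := j + 4) (by omega) (by omega) hs, show j + 4 + 2 = j + 6 by rfl]
  obtain ⟨c0, c1, c2, c3⟩ := zeroCount_five hj
  fin_cases i <;> simp <;> omega

theorem Z_six {j : ℕ} (hj : 1 ≤ j) {s : ℕ} (i : Fin 4) (hs : s + 4 = 6 * 2 ^ (j + 2) + i) :
    Z s + ![2, 2, 0, 0] i = 2 ^ (j + 2) * ![12, 10, 11, 12] i := by
  have h2 : 2 ≤ 2 ^ j := Nat.le_self_pow (by omega) 2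
  have e2 : 2 ^ (j + 2) = 4 * 2 ^ j := by ring
  have e4 : 2 ^ (j + 4) = 16 * 2 ^ j := by ring
  have e5 : 2 ^ (j + 4 + 1) = 32 * 2 ^ j := by ring
  have hi := i.isLt
  rw [Z_eq (k := j + 4) (by omega) (by omega) hs, show j + 4 + 2 = j + 6 by rfl]
  obtain ⟨c0, c1, c2, c3⟩ := zeroCount_six hj
  fin_cases i <;> simp <;> omega

theorem Z_eight {j : ℕ} (hj : 1 ≤ j) {s : ℕ} (i : Fin 4) (hs : s + 4 = 8 * 2 ^ (j + 2) + i) :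
    Z s = 2 ^ (j + 2) * ![8, 8, 12, 16] i := by
  have h2 : 2 ≤ 2 ^ j := Nat.le_self_pow (by omega) 2
  have e2 : 2 ^ (j + 2) = 4 * 2 ^ j := by ring
  have e4 : 2 ^ (j + 4) = 16 * 2 ^ j := by ring
  have e5 : 2 ^ (j + 4 + 1) = 32 * 2 ^ j := by ring
  have e6 : 2 ^ (j + 5 + 1) = 64 * 2 ^ j := by ring
  have hi := i.isLt
  obtain ⟨c0, c1, c2, c3⟩ := zeroCount_eight hj
  rcases Nat.eq_zero_or_pos (i : ℕ) with h | h
  · rw [Z_eq (k := j + 4) (by omega) (by omega) hs, show j + 4 + 2 = j + 6 by rfl]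
    obtain rfl : i = 0 := Fin.ext h
    simp
    omega
  · rw [Z_eq (k := j + 5) (by omega) (by omega) hs, show j + 5 + 2 = j + 7 by rfl]
    fin_cases i <;> simp at h ⊢ <;> omega

end Vieru

/-! ### Assembly of the six cases -/

theorem mainTheorem9 :
    -- the initial block
    (∀ i : Fin 32, Vieru.Z (2 ^ 5 + (i : ℕ)) = Vieru.Z5 i) ∧
    ∀ k : ℕ, 6 ≤ k →
      -- (A)
      (∀ s : ℕ, 2 ^ k ≤ s → s ≤ 2 ^ k + 2 ^ (k - 2) - 5 →
        Vieru.Z s = 2 * Vieru.Z (s - 2 ^ (k - 1))) ∧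
      -- (B)
      (∀ (s : ℕ) (i : Fin 4), s = 2 ^ k + 2 ^ (k - 2) - 5 + ((i : ℕ) + 1) →
        Vieru.Z s = Vieru.Z (s - 2 ^ (k - 1) - 2 ^ (k - 3)) + Vieru.c k i) ∧
      -- (C)
      (∀ s : ℕ, 2 ^ k + 2 ^ (k - 2) ≤ s → s ≤ 2 ^ k + 2 ^ (k - 1) - 5 →
        (Vieru.Z s : ℤ) = 2 * (Vieru.Z (s - 2 ^ (k - 1)) : ℤ) - (Vieru.d k s : ℤ)) ∧
      -- (D)
      (∀ (s : ℕ) (i : Fin 4), s = 2 ^ k + 2 ^ (k - 1) - 5 + ((i : ℕ) + 1) →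
        Vieru.Z s = Vieru.Z (s - 2 ^ (k - 1) - 2 ^ (k - 2)) + Vieru.c' k i) ∧
      -- (E)
      (∀ s : ℕ, 2 ^ k + 2 ^ (k - 1) ≤ s → s ≤ 2 ^ (k + 1) - 5 →
        Vieru.Z s = Vieru.Z (s - 2 ^ k) + 2 ^ (k + 1)) ∧
      -- (F)
      (∀ (s : ℕ) (i : Fin 4), s = 2 ^ (k + 1) - 5 + ((i : ℕ) + 1) →
        Vieru.Z s = Vieru.Z (s - 2 ^ k) + Vieru.c'' k i) := by
  refine ⟨Vieru.Z_initial_block, fun k hk => ?_⟩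
  obtain ⟨j, rfl⟩ := Nat.exists_eq_add_of_le' hk
  have h1 := Nat.one_le_two_pow (n := j)
  have p1 : 2 ^ (j + 1) = 2 * 2 ^ j := by ring
  have p2 : 2 ^ (j + 2) = 4 * 2 ^ j := by ring
  have p3 : 2 ^ (j + 3) = 8 * 2 ^ j := by ring
  have p4 : 2 ^ (j + 4) = 16 * 2 ^ j := by ring
  have p5 : 2 ^ (j + 5) = 32 * 2 ^ j := by ring
  have p6 : 2 ^ (j + 6) = 64 * 2 ^ j := by ring
  have p7 : 2 ^ (j + 7) = 128 * 2 ^ j := by ring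
  simp only [show j + 6 - 1 = j + 5 by rfl, show j + 6 - 2 = j + 4 by rfl,
    show j + 6 - 3 = j + 3 by rfl, show j + 6 + 1 = j + 7 by rfl]
  refine ⟨fun s hs hs' => ?_, fun s i hs => ?_, fun s hs hs' => ?_, fun s i hs => ?_,
    fun s hs hs' => ?_, fun s i hs => ?_⟩
  -- Here 2^(j+4) = 2^(k-2) serves as M, and the bounds on s say exactly 4 ≤ r < M.
  · obtain ⟨r, hr⟩ : ∃ r, s + 4 = 4 * 2 ^ (j + 4) + r := ⟨s + 4 - 4 * 2 ^ (j + 4), by omega⟩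
    rw [Vieru.Z_eq (k := j + 6) (by omega) (by omega) hr,
      Vieru.Z_eq (k := j + 5) (T := 2) (j := j + 4) (r := r) (by omega) (by omega) (by omega)]
    exact Vieru.zeroCount_first_quarter (by omega) (by omega) (by omega)
  · have e1 := Vieru.Z_five (j := j + 2) (by omega) i (s := s) (by
      rw [show j + 2 + 2 = j + 4 by rfl]; omega)
    have e2 := Vieru.Z_five (j := j + 1) (by omega) i (s := s - 2 ^ (j + 5) - 2 ^ (j + 3)) (by
      rw [show j + 1 + 2 = j + 3 by rfl]; omega)
    rw [Vieru.c, show j + 6 - 5 = j + 1 by rfl]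
    rw [show j + 2 + 2 = j + 4 by rfl] at e1
    rw [show j + 1 + 2 = j + 3 by rfl] at e2
    fin_cases i <;> simp at e1 e2 ⊢ <;> omega
  · obtain ⟨r, hr⟩ : ∃ r, s + 4 = 5 * 2 ^ (j + 4) + r := ⟨s + 4 - 5 * 2 ^ (j + 4), by omega⟩
    rw [Vieru.Z_eq (k := j + 6) (by omega) (by omega) hr,
      Vieru.Z_eq (k := j + 5) (T := 3) (j := j + 4) (r := r) (by omega) (by omega) (by omega),
      Vieru.d_eq (j := j + 4) (by omega) (by omega) hr]
    have := Vieru.zeroCount_second_quarter (j := j + 4) (r := r) (by omega) (by omega) (by omega)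
    rw [show j + 6 + 2 = j + 4 + 4 by rfl, show j + 5 + 2 = j + 4 + 3 by rfl]
    simp only [Nat.cast_ofNat]
    omega
  · have e1 := Vieru.Z_six (j := j + 2) (by omega) i (s := s) (by
      rw [show j + 2 + 2 = j + 4 by rfl]; omega)
    have e2 := Vieru.Z_six (j := j + 1) (by omega) i (s := s - 2 ^ (j + 5) - 2 ^ (j + 4)) (by
      rw [show j + 1 + 2 = j + 3 by rfl]; omega)
    rw [Vieru.c', show j + 6 - 5 = j + 1 by rfl]
    rw [show j + 2 + 2 = j + 4 by rfl] at e1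
    rw [show j + 1 + 2 = j + 3 by rfl] at e2
    fin_cases i <;> simp at e1 e2 ⊢ <;> omega
  · obtain ⟨r, hr⟩ : ∃ r, s + 4 = 6 * 2 ^ (j + 4) + r := ⟨s + 4 - 6 * 2 ^ (j + 4), by omega⟩
    rw [Vieru.Z_eq (k := j + 6) (by omega) (by omega) hr,
      Vieru.Z_eq (k := j + 5) (T := 2) (j := j + 4) (r := r) (by omega) (by omega) (by omega)]
    exact Vieru.zeroCount_second_half (by omega) (by omega) (by omega)
  · have e1 := Vieru.Z_eight (j := j + 2) (by omega) i (s := s) (by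
      rw [show j + 2 + 2 = j + 4 by rfl]; omega)
    have e2 := Vieru.Z_eight (j := j + 1) (by omega) i (s := s - 2 ^ (j + 6)) (by
      rw [show j + 1 + 2 = j + 3 by rfl]; omega)
    rw [Vieru.c'', show j + 6 - 5 = j + 1 by rfl]
    rw [show j + 2 + 2 = j + 4 by rfl] at e1
    rw [show j + 1 + 2 = j + 3 by rfl] at e2
    fin_cases i <;> simp at e1 e2 ⊢ <;> omega
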